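/- Let $\mathcal V_\uparrow,\mathcal V_\downarrow$ be complex $\mathbb Z_2$-graded vector spaces (of any dimension), and let $\pi_\sigma$ be an even (grading-preserving) projector on $\mathcal V_\sigma$, $\sigma=\uparrow,\downarrow$. Put $\bar\pi_\sigma=\mathbb I-\pi_\sigma$, $C^\sigma=\pi_\sigma-\bar\pi_\sigma$, let $P^\sigma_{12}(u\otimes v)=(-1)^{[u][v]}\,v\otimes u$ be the graded permutation on $\mathcal V_\sigma\otimes\mathcal V_\sigma$, and let $A_j$ denote the operator $A$ acting in the $j$-th tensor factor. With $\Sigma^\sigma_{12}=(\pi_\sigma)_1(\bar\pi_\sigma)_2+(\bar\pi_\sigma)_1(\pi_\sigma)_2$ define the universal XX $R$-matrices $$R^\sigma_{12}(\lambda)=\Sigma^\sigma_{12}P^\sigma_{12}+\Sigma^\sigma_{12}\sin\lambda+(\mathbb I\otimes\mathbb I-\Sigma^\sigma_{12})P^\sigma_{12}\cos\lambda ,$$ and denote by $R^\sigma_{ij}$ the same operator acting in the factors $i,j$ of a tensor power of $\mathcal V_\sigma$ (so that $R^\sigma_{21}=P^\sigma_{12}R^\sigma_{12}P^\sigma_{12}$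 and $R^\sigma_{13}=P^\sigma_{23}R^\sigma_{12}P^\sigma_{23}$). Let $U\in\mathbb C$ and let $h:\mathbb C\to\mathbb C$ be any function with $$\sinh(2h(\lambda))=U\sin(2\lambda)\qquad\text{for all }\lambda .$$ Write $\lambda_{ij}=\lambda_i-\lambda_j$, $\lambda'_{ij}=\lambda_i+\lambda_j$, $h_{ij}=h(\lambda_i)-h(\lambda_j)$, $h'_{ij}=h(\lambda_i)+h(\lambda_j)$. The Hubbard $R$-matrix, acting on the tensor product of the $\uparrow$ spaces and the $\downarrow$ spaces, is $$R^{\uparrow\downarrow}_{ij}(\lambda_i,\lambda_j)=R^\uparrow_{ij}(\lambda_{ij})R^\downarrow_{ij}(\lambda_{ij})+\frac{\sin\lambda_{ij}}{\sin\lambda'_{ij}}\tanh(h'_{ij})\,R^\uparrow_{ij}(\lambda'_{ij})C^\uparrow_iR^\downarrow_{ij}(\lambda'_{ij})C^\downarrow_i ,$$ defined when $\sin\lambda'_{ij}\neq0$ and $\cosh h'_{ij}\ne0$. Then: 1. (Yang–Baxter equation) For all $\lambda_1,\lambda_2,\lambda_3\in\mathbb C$ for which the three $R$-matrices are defined, $$R^{\uparrow\downarrow}_{12}(\lambda_1,\lambda_2)R^{\uparrow\downarrow}_{13}(\lambda_1,\lambda_3)R^{\uparrow\downarrow}_{23}(\lambda_2,\lambda_3)=R^{\uparrow\downarrow}_{23}(\lambda_2,\lambda_3)R^{\uparrow\downarrow}_{13}(\lambda_1,\lambda_3)R^{\uparrow\downarrow}_{12}(\lambda_1,\lambda_2).$$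 2. (Unitarity) For all $\lambda_1,\lambda_2$ with $\sin\lambda'_{12}\neq0$ and $\cosh h'_{12}\ne0$, $$R^{\uparrow\downarrow}_{12}(\lambda_1,\lambda_2)R^{\uparrow\downarrow}_{21}(\lambda_2,\lambda_1)=\Big(\cos^4\lambda_{12}-\Big(\frac{\sin\lambda_{12}}{\sin\lambda'_{12}}\tanh h'_{12}\Big)^2\cos^4\lambda'_{12}\Big)\,\mathbb I .$$ If moreover $\cosh h_{12}\neq0$, this coefficient equals $$\cos^2\lambda_{12}\,\big(\cos^2\lambda_{12}-(\tanh h_{12}\,\cos\lambda'_{12})^2\big).$$ 3. If $\sin\lambda'_{12}$, $\cos\lambda'_{12}$, $\cosh h'_{12}$, $\cosh h_{12}$ are all nonzero, then also $$\cos^4\lambda_{12}-\Big(\frac{\sin\lambda_{12}}{\sin\lambda'_{12}}\tanh h'_{12}\Big)^2=\cos^2\lambda_{12}\Big(\cos^2\lambda_{12}-\Big(\frac{\tanh h_{12}}{\cos\lambda'_{12}}\Big)^2\Big).$$ -/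

import Mathlib

open scoped TensorProduct

noncomputable section

namespace UniversalHubbard

section OneSpecies

variable {V : Type*} [AddCommGroup V] [Module ℂ V]

/-- The graded permutation `P₁₂` on `V ⊗ V`, `u ⊗ v ↦ (-1)^([u][v]) v ⊗ u`, for the
`ℤ₂`-graded complex vector space `V = 𝒱 0 ⊕ 𝒱 1`: Mathlib's graded braiding, transported
along `V ≃ ⨁ i, 𝒱 i`. -/
def P (𝒱 : ZMod 2 → Submodule ℂ V) [DirectSum.Decomposition 𝒱] : Module.End ℂ (V ⊗[ℂ] V) :=
  let e := DirectSum.decomposeLinearEquiv 𝒱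
  ((TensorProduct.congr e e).trans
    ((TensorProduct.gradedComm ℂ (fun i => 𝒱 i) (fun i => 𝒱 i)).trans
      (TensorProduct.congr e.symm e.symm))).toLinearMap

/-- The graded permutation on homogeneous vectors. -/
theorem P_tmul (𝒱 : ZMod 2 → Submodule ℂ V) [DirectSum.Decomposition 𝒱]
    {i j : ZMod 2} {u v : V} (hu : u ∈ 𝒱 i) (hv : v ∈ 𝒱 j) :
    P 𝒱 (u ⊗ₜ[ℂ] v) = (-1 : ℂ) ^ (i.val * j.val) • (v ⊗ₜ[ℂ] u) := by
  have e1 : DirectSum.decomposeLinearEquiv 𝒱 u = DirectSum.lof ℂ _ (fun i => 𝒱 i) i ⟨u, hu⟩ :=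
    DirectSum.decompose_of_mem 𝒱 hu
  have e2 : DirectSum.decomposeLinearEquiv 𝒱 v = DirectSum.lof ℂ _ (fun i => 𝒱 i) j ⟨v, hv⟩ :=
    DirectSum.decompose_of_mem 𝒱 hv
  have hs : ((-1 : ℤˣ) ^ (j * i) : ℤˣ) = (-1 : ℤˣ) ^ (i.val * j.val) := by
    fin_cases i <;> fin_cases j <;> rfl
  simp only [P, LinearEquiv.coe_coe, LinearEquiv.trans_apply, TensorProduct.congr_tmul]
  rw [e1, e2, TensorProduct.gradedComm_of_tmul_of, hs, Units.smul_def,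
    ← Int.cast_smul_eq_zsmul ℂ, map_smul, TensorProduct.congr_tmul, ← e1, ← e2]
  simp

/-- `A₁ = A ⊗ 𝕀`. -/
def op1 (A : Module.End ℂ V) : Module.End ℂ (V ⊗[ℂ] V) := TensorProduct.map A 1

/-- `A₂ = 𝕀 ⊗ A` (without signs: it is only used for even `A`). -/
def op2 (A : Module.End ℂ V) : Module.End ℂ (V ⊗[ℂ] V) := TensorProduct.map 1 A

/-- `Σ₁₂ = π₁ π̄₂ + π̄₁ π₂`, with `π̄ = 𝕀 - π`. -/
def Sig (π : Module.End ℂ V) : Module.End ℂ (V ⊗[ℂ] V) :=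
  op1 π * op2 (1 - π) + op1 (1 - π) * op2 π

/-- The parity operator `C = π - π̄`. -/
def C (π : Module.End ℂ V) : Module.End ℂ V := π - (1 - π)

/-- The `R`-matrix of the universal XX model:
`R₁₂(λ) = Σ₁₂ P₁₂ + Σ₁₂ sin λ + (𝕀 ⊗ 𝕀 - Σ₁₂) P₁₂ cos λ`. -/
def RXX (𝒱 : ZMod 2 → Submodule ℂ V) [DirectSum.Decomposition 𝒱] (π : Module.End ℂ V) (l : ℂ) :
    Module.End ℂ (V ⊗[ℂ] V) :=
  Sig π * P 𝒱 + Complex.sin l • Sig π + Complex.cos l • ((1 - Sig π) * P 𝒱)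

/-- `X₂₁ = P₁₂ X₁₂ P₁₂`. -/
def leg21 (𝒱 : ZMod 2 → Submodule ℂ V) [DirectSum.Decomposition 𝒱]
    (X : Module.End ℂ (V ⊗[ℂ] V)) : Module.End ℂ (V ⊗[ℂ] V) :=
  P 𝒱 * X * P 𝒱

/-- `X₁₂` on `V ⊗ V ⊗ V`: the operator `X` acting in the factors 1 and 2. -/
def leg12 (X : Module.End ℂ (V ⊗[ℂ] V)) : Module.End ℂ (V ⊗[ℂ] V ⊗[ℂ] V) :=
  LinearMap.rTensor V X

/-- `X₂₃` on `V ⊗ V ⊗ V`: the (even) operator `X` acting in the factors 2 and 3. -/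
def leg23 (X : Module.End ℂ (V ⊗[ℂ] V)) : Module.End ℂ (V ⊗[ℂ] V ⊗[ℂ] V) :=
  (TensorProduct.assoc ℂ V V V).symm.toLinearMap ∘ₗ LinearMap.lTensor V X ∘ₗ
    (TensorProduct.assoc ℂ V V V).toLinearMap

/-- `X₁₃ = P₂₃ X₁₂ P₂₃` on `V ⊗ V ⊗ V`: the operator `X` acting in the factors 1 and 3. -/
def leg13 (𝒱 : ZMod 2 → Submodule ℂ V) [DirectSum.Decomposition 𝒱]
    (X : Module.End ℂ (V ⊗[ℂ] V)) : Module.End ℂ (V ⊗[ℂ] V ⊗[ℂ] V) :=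
  leg23 (P 𝒱) * leg12 X * leg23 (P 𝒱)

end OneSpecies

section TwoSpecies

variable {V W E F : Type*} [AddCommGroup V] [Module ℂ V] [AddCommGroup W] [Module ℂ W]
  [AddCommGroup E] [Module ℂ E] [AddCommGroup F] [Module ℂ F]

/-- The Hubbard coupling coefficient
`sin(λ₁ - λ₂) / sin(λ₁ + λ₂) * tanh(h(λ₁) + h(λ₂))`. -/
def coupling (h : ℂ → ℂ) (l₁ l₂ : ℂ) : ℂ :=
  Complex.sin (l₁ - l₂) / Complex.sin (l₁ + l₂) * Complex.tanh (h l₁ + h l₂)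

/-- The Hubbard `R`-matrix
`R↑(λ₁₂) R↓(λ₁₂) + (sin λ₁₂ / sin λ'₁₂) tanh(h'₁₂) R↑(λ'₁₂) C₁↑ R↓(λ'₁₂) C₁↓`
in auxiliary space notation. The `↑` operators act on `E`, the `↓` operators on `F`, and the
Hubbard `R`-matrix on `E ⊗ F`; `ι` and `κ` place an operator on `V ⊗ V` (resp. `W ⊗ W`) into the
chosen pair of factors of `E` (resp. `F`). -/
def hubbardR (𝒱 : ZMod 2 → Submodule ℂ V) [DirectSum.Decomposition 𝒱]
    (𝒲 : ZMod 2 → Submodule ℂ W) [DirectSum.Decomposition 𝒲]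
    (πup : Module.End ℂ V) (πdn : Module.End ℂ W) (h : ℂ → ℂ)
    (ι : Module.End ℂ (V ⊗[ℂ] V) → Module.End ℂ E) (κ : Module.End ℂ (W ⊗[ℂ] W) → Module.End ℂ F)
    (l₁ l₂ : ℂ) : Module.End ℂ (E ⊗[ℂ] F) :=
  TensorProduct.map (ι (RXX 𝒱 πup (l₁ - l₂))) (κ (RXX 𝒲 πdn (l₁ - l₂))) +
    coupling h l₁ l₂ •
      TensorProduct.map
        (ι (RXX 𝒱 πup (l₁ + l₂) * op1 (C πup)))
        (κ (RXX 𝒲 πdn (l₁ + l₂) * op1 (C πdn)))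

variable (𝒱 : ZMod 2 → Submodule ℂ V) [DirectSum.Decomposition 𝒱]
  (𝒲 : ZMod 2 → Submodule ℂ W) [DirectSum.Decomposition 𝒲]
  (πup : Module.End ℂ V) (πdn : Module.End ℂ W) (h : ℂ → ℂ) (l m : ℂ)

/-- `R↑↓₁₂(l, m)` on two sites, that is on `(V ⊗ V) ⊗ (W ⊗ W)`. -/
def hubbard12 : Module.End ℂ ((V ⊗[ℂ] V) ⊗[ℂ] (W ⊗[ℂ] W)) :=
  hubbardR 𝒱 𝒲 πup πdn h id id l m

/-- `R↑↓₂₁(l, m)` on two sites. -/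
def hubbard21 : Module.End ℂ ((V ⊗[ℂ] V) ⊗[ℂ] (W ⊗[ℂ] W)) :=
  hubbardR 𝒱 𝒲 πup πdn h (leg21 𝒱) (leg21 𝒲) l m

/-- `R↑↓₁₂(l, m)` on three sites, that is on `(V ⊗ V ⊗ V) ⊗ (W ⊗ W ⊗ W)`. -/
def hubbardThree12 : Module.End ℂ ((V ⊗[ℂ] V ⊗[ℂ] V) ⊗[ℂ] (W ⊗[ℂ] W ⊗[ℂ] W)) :=
  hubbardR 𝒱 𝒲 πup πdn h leg12 leg12 l m

/-- `R↑↓₁₃(l, m)` on three sites. -/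
def hubbardThree13 : Module.End ℂ ((V ⊗[ℂ] V ⊗[ℂ] V) ⊗[ℂ] (W ⊗[ℂ] W ⊗[ℂ] W)) :=
  hubbardR 𝒱 𝒲 πup πdn h (leg13 𝒱) (leg13 𝒲) l m

/-- `R↑↓₂₃(l, m)` on three sites. -/
def hubbardThree23 : Module.End ℂ ((V ⊗[ℂ] V ⊗[ℂ] V) ⊗[ℂ] (W ⊗[ℂ] W ⊗[ℂ] W)) :=
  hubbardR 𝒱 𝒲 πup πdn h leg23 leg23 l m

end TwoSpecies

end UniversalHubbard

end

noncomputable section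

namespace UniversalHubbard

/-! The grading and the dimension enter only through a few relations: the permutations square to
one, satisfy the braid relation and intertwine commuting idempotents. Everything about one species
is therefore proved in an abstract `ℂ`-algebra acting on itself from the left. There `1` splits into
joint eigenelements of the projectors, with eigenvalues ("colours") 0 or 1. On colours `a`, `b` the
XX matrix acts as `perm • P + stay`: this is `P + sin λ` for different colours and `cos λ • P` for
equal ones. A product of three such matrices becomes a combination of the six permutations of an
eigenelement (`triple_mul`, `triple_mul_rev`), and identities reduce to trigonometry for eight
colourings.

Expanding the Hubbard Yang–Baxter equation gives eight terms, according to which factors carry a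
parity operator. Terms with zero or two insertions agree on both sides for each species separately
(the `yang_baxter_*` lemmas). Terms with one or three do not. For these, let `Tᵢ`, `Sᵢ` be the
forward and backward products: `Tᵢ - Sᵢ` is the same up to an alternating sign, and two linear
relations hold among the `Tᵢ + Sᵢ` (`sum_eq_zero`, `sum_eq_zero_all`). The constraint on `h` puts
the coupling weights in the span of these two relations (`exists_coupling_eq`), and
`bilinear_sum_eq` then joins the two species.

Unitarity follows from products of two XX matrices; its cross terms cancel because the coupling is
antisymmetric. The alternative forms of the coefficient follow from `coupling_mul_cos`. -/

theorem swap_symm {A : Type*} [Monoid A] {P p q : A} (hP : P * P = 1) (h : P * p = q * P) :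
    P * q = p * P := by
  calc P * q = P * (q * P) * P := by rw [mul_assoc, mul_assoc, hP, mul_one]
    _ = p * P := by rw [← h, ← mul_assoc, hP, one_mul]

/-! ### One species: XX matrices in an abstract algebra, acting on eigenelements. -/

section Algebra

variable {A : Type*} [Ring A] [Algebra ℂ A]

/-- The universal XX `R`-matrix built from a permutation `P` and projectors `p`, `q`. -/
def rmat (P p q : A) (l : ℂ) : A :=
  (p * (1 - q) + (1 - p) * q) * P + Complex.sin l • (p * (1 - q) + (1 - p) * q) +
    Complex.cos l • ((1 - (p * (1 - q) + (1 - p) * q)) * P)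

/-- The amplitude with which `rmat` permutes two particles of colours `a`, `b`. -/
def perm (a b k : ℂ) : ℂ := (a * (1 - b) + (1 - a) * b) + (1 - (a * (1 - b) + (1 - a) * b)) * k

/-- The amplitude with which `rmat` leaves two particles of colours `a`, `b` in place. -/
def stay (a b s : ℂ) : ℂ := (a * (1 - b) + (1 - a) * b) * s

theorem sig_mul {p q m : A} {a b : ℂ} (hp : p * m = a • m) (hq : q * m = b • m) :
    (p * (1 - q) + (1 - p) * q) * m = (a * (1 - b) + (1 - a) * b) • m := by
  simp only [add_mul, mul_assoc, sub_mul, one_mul, hq, mul_sub, mul_smul_comm, hp, smul_smul]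
  module

theorem rmat_mul {P p q m : A} {a b : ℂ} (hp : p * m = a • m) (hq : q * m = b • m)
    (hp' : p * (P * m) = b • (P * m)) (hq' : q * (P * m) = a • (P * m)) (l : ℂ) :
    rmat P p q l * m =
      perm a b (Complex.cos l) • (P * m) + stay a b (Complex.sin l) • m := by
  have h1 := sig_mul hp hq
  have h2 := sig_mul hp' hq'
  simp only [rmat, perm, stay]
  rw [add_mul, add_mul, mul_assoc, h2, smul_mul_assoc, h1, smul_mul_assoc, mul_assoc,
    sub_mul 1 _ (P * m), one_mul, h2]
  module

/-- Any `m` is the sum of `p * m` and `m - p * m`, of eigenvalues 1 and 0. The predicate `S` carries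
the eigenvalue equations already obtained for other projectors, so that the lemma can be nested. -/
theorem mul_eq_mul_of_eigenvectors {p X Y : A} (hp : p * p = p) (S : A → Prop)
    (hS : ∀ m, S m → S (p * m) ∧ S (m - p * m))
    (hXY : ∀ a : ℂ, a = 0 ∨ a = 1 → ∀ m, S m → p * m = a • m → X * m = Y * m) (m : A) (hm : S m) :
    X * m = Y * m := by
  have h1 := hXY 1 (Or.inr rfl) (p * m) (hS m hm).1 (by rw [← mul_assoc, hp, one_smul])
  have h0 := hXY 0 (Or.inl rfl) (m - p * m) (hS m hm).2
    (by rw [mul_sub, ← mul_assoc, hp, sub_self, zero_smul])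
  rw [mul_sub, mul_sub, h1] at h0
  exact sub_left_injective h0

theorem mul_eigenvector {p q m : A} {a : ℂ} (hpq : p * q = q * p) (h : p * m = a • m) :
    p * (q * m) = a • (q * m) ∧ p * (m - q * m) = a • (m - q * m) := by
  have : p * (q * m) = a • (q * m) := by rw [← mul_assoc, hpq, mul_assoc, h, mul_smul_comm]
  exact ⟨this, by rw [mul_sub, this, h, smul_sub]⟩

theorem swap_eigenvector {P p q m : A} {a : ℂ} (h : P * p = q * P) (hm : p * m = a • m) :
    q * (P * m) = a • (P * m) := by
  rw [← mul_assoc, ← h, mul_assoc, hm, mul_smul_comm]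

/-- The relations between the permutations `P = P₁₂`, `Q = P₂₃` and the projectors on three
sites. -/
structure ThreeSites (P Q p₁ p₂ p₃ : A) : Prop where
  P_sq : P * P = 1
  Q_sq : Q * Q = 1
  braid : P * (Q * P) = Q * (P * Q)
  P_one : P * p₁ = p₂ * P
  P_three : P * p₃ = p₃ * P
  Q_one : Q * p₁ = p₁ * Q
  Q_two : Q * p₂ = p₃ * Q
  comm_one_two : p₁ * p₂ = p₂ * p₁
  comm_one_three : p₁ * p₃ = p₃ * p₁
  comm_two_three : p₂ * p₃ = p₃ * p₂
  idem_one : p₁ * p₁ = p₁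
  idem_two : p₂ * p₂ = p₂
  idem_three : p₃ * p₃ = p₃

/-- `m` is a joint eigenvector: the three particles have colours `a`, `b`, `c`. -/
structure Coloured (p₁ p₂ p₃ m : A) (a b c : ℂ) : Prop where
  one : p₁ * m = a • m
  two : p₂ * m = b • m
  three : p₃ * m = c • m

/-! ### Three sites: action of triple products on coloured elements. -/

namespace ThreeSites

variable {P Q p₁ p₂ p₃ : A} (H : ThreeSites P Q p₁ p₂ p₃)
include H

theorem ext_coloured {X Y : A}
    (h : ∀ (m : A) (a b c : ℂ), a = 0 ∨ a = 1 → b = 0 ∨ b = 1 → c = 0 ∨ c = 1 →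
      Coloured p₁ p₂ p₃ m a b c → X * m = Y * m) : X = Y := by
  have key := mul_eq_mul_of_eigenvectors (X := X) (Y := Y) H.idem_one (fun _ => True)
    (fun _ _ => ⟨trivial, trivial⟩)
    (fun a ha m _ hm => mul_eq_mul_of_eigenvectors H.idem_two (fun m => p₁ * m = a • m)
      (fun m hm => mul_eigenvector H.comm_one_two hm)
      (fun b hb m hm hm' => mul_eq_mul_of_eigenvectors H.idem_three
        (fun m => p₁ * m = a • m ∧ p₂ * m = b • m)
        (fun m hm => ⟨⟨(mul_eigenvector H.comm_one_three hm.1).1,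
          (mul_eigenvector H.comm_two_three hm.2).1⟩,
          ⟨(mul_eigenvector H.comm_one_three hm.1).2, (mul_eigenvector H.comm_two_three hm.2).2⟩⟩)
        (fun c hc m hm hm' => h m a b c ha hb hc ⟨hm.1, hm.2, hm'⟩) m ⟨hm, hm'⟩) m hm) 1 trivial
  simpa using key

variable {m : A} {a b c : ℂ}

theorem coloured_P (hm : Coloured p₁ p₂ p₃ m a b c) : Coloured p₁ p₂ p₃ (P * m) b a c :=
  ⟨swap_eigenvector (swap_symm H.P_sq H.P_one) hm.two, swap_eigenvector H.P_one hm.one,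
    swap_eigenvector H.P_three hm.three⟩

theorem coloured_Q (hm : Coloured p₁ p₂ p₃ m a b c) : Coloured p₁ p₂ p₃ (Q * m) a c b :=
  ⟨swap_eigenvector H.Q_one hm.one, swap_eigenvector (swap_symm H.Q_sq H.Q_two) hm.three,
    swap_eigenvector H.Q_two hm.two⟩

theorem rmat12_mul (hm : Coloured p₁ p₂ p₃ m a b c) (l : ℂ) :
    rmat P p₁ p₂ l * m = perm a b (Complex.cos l) • (P * m) + stay a b (Complex.sin l) • m :=
  rmat_mul hm.one hm.two (H.coloured_P hm).one (H.coloured_P hm).two l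

theorem rmat23_mul (hm : Coloured p₁ p₂ p₃ m a b c) (l : ℂ) :
    rmat Q p₂ p₃ l * m = perm b c (Complex.cos l) • (Q * m) + stay b c (Complex.sin l) • m :=
  rmat_mul hm.two hm.three (H.coloured_Q hm).two (H.coloured_Q hm).three l

/-- Conjugation by `Q` brings colour `c` next to `a`; the braid relation rewrites `QPQ` as `PQP`,
the exchange of the outer particles. -/
theorem rmat13_mul (hm : Coloured p₁ p₂ p₃ m a b c) (l : ℂ) :
    Q * rmat P p₁ p₂ l * Q * m =
      perm a c (Complex.cos l) • (P * (Q * (P * m))) + stay a c (Complex.sin l) • m := by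
  rw [mul_assoc, mul_assoc, H.rmat12_mul (H.coloured_Q hm), mul_add, mul_smul_comm, mul_smul_comm,
    ← mul_assoc Q Q, H.Q_sq, one_mul, ← mul_assoc P Q m, ← mul_assoc Q, ← H.braid, mul_assoc,
    mul_assoc]

theorem coloured_PQP (hm : Coloured p₁ p₂ p₃ m a b c) :
    Coloured p₁ p₂ p₃ (P * (Q * (P * m))) c b a :=
  H.coloured_P (H.coloured_Q (H.coloured_P hm))

open Complex in
/-- The product of three `R`-matrices in the order `12`, `13`, `23`, with a diagonal operator to
the right of each. -/
theorem triple_mul {K L N : A} {κ ν ρ : ℂ → ℂ}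
    (hK : ∀ {m : A} {a b c : ℂ}, Coloured p₁ p₂ p₃ m a b c → K * m = κ a • m)
    (hL : ∀ {m : A} {a b c : ℂ}, Coloured p₁ p₂ p₃ m a b c → L * m = ν a • m)
    (hN : ∀ {m : A} {a b c : ℂ}, Coloured p₁ p₂ p₃ m a b c → N * m = ρ b • m)
    (hm : Coloured p₁ p₂ p₃ m a b c) (x y z : ℂ) :
    (rmat P p₁ p₂ x * K) * ((Q * rmat P p₁ p₂ y * Q) * L) * (rmat Q p₂ p₃ z * N) * m =
      (ρ b * ν a * κ a * stay b c (sin z) * stay a c (sin y) * stay a b (sin x)) • m +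
      (ρ b * ν a * κ a * stay b c (sin z) * stay a c (sin y) * perm a b (cos x)) • (P * m) +
      (ρ b * ν a * κ a * perm b c (cos z) * stay a b (sin y) * stay a c (sin x)) • (Q * m) +
      (ρ b * ν a * κ a * perm b c (cos z) * stay a b (sin y) * perm a c (cos x)) •
        (P * (Q * m)) +
      (ρ b * ν a * (κ b * perm b c (cos z) * perm a b (cos y) * stay b c (sin x) +
        κ c * stay b c (sin z) * perm a c (cos y) * perm c b (cos x))) • (Q * (P * m)) +
      (ρ b * ν a * (κ b * perm b c (cos z) * perm a b (cos y) * perm b c (cos x) +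
        κ c * stay b c (sin z) * perm a c (cos y) * stay c b (sin x))) • (P * (Q * (P * m))) := by
  have hQ := H.coloured_Q hm
  have hF := H.coloured_PQP hm
  have hQF := H.coloured_PQP hQ
  have hP (n : A) : P * (P * n) = n := by rw [← mul_assoc, H.P_sq, one_mul]
  have hB (n : A) : Q * (P * (Q * n)) = P * (Q * (P * n)) := by
    rw [← mul_assoc P Q n, ← mul_assoc Q, ← H.braid, mul_assoc, mul_assoc]
  -- `PQPQ = QP`: words in `P`, `Q` are brought to the normal forms `1`, `P`, `Q`, `PQ`, `QP`,
  -- `PQP`.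
  simp only [hB, hP] at hQF
  have h1 := H.rmat13_mul hm y
  have h2 := H.rmat13_mul hQ y
  simp only [hB, hP] at h2
  -- Kept opaque, so that `mul_assoc` does not split the matrix in the factors 1 and 3.
  generalize Q * rmat P p₁ p₂ y * Q = Y at h1 h2
  simp only [mul_assoc, hN hm, H.rmat23_mul hm, mul_smul_comm, mul_add, hL hm, hL hQ, h1, h2,
    hK hm, hK hF, hK hQF, hK hQ, H.rmat12_mul hm, H.rmat12_mul hQ, H.rmat12_mul hF,
    H.rmat12_mul hQF, hP]
  module

open Complex in
/-- The product of three `R`-matrices in the order `23`, `13`, `12`, with a diagonal operator to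
the right of each. -/
theorem triple_mul_rev {K L N : A} {κ ν ρ : ℂ → ℂ}
    (hK : ∀ {m : A} {a b c : ℂ}, Coloured p₁ p₂ p₃ m a b c → K * m = κ a • m)
    (hL : ∀ {m : A} {a b c : ℂ}, Coloured p₁ p₂ p₃ m a b c → L * m = ν a • m)
    (hN : ∀ {m : A} {a b c : ℂ}, Coloured p₁ p₂ p₃ m a b c → N * m = ρ b • m)
    (hm : Coloured p₁ p₂ p₃ m a b c) (x y z : ℂ) :
    (rmat Q p₂ p₃ z * N) * ((Q * rmat P p₁ p₂ y * Q) * L) * (rmat P p₁ p₂ x * K) * m =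
      (κ a * ν a * ρ b * stay a b (sin x) * stay a c (sin y) * stay b c (sin z)) • m +
      (κ a * ν b * ρ a * perm a b (cos x) * stay b c (sin y) * stay a c (sin z)) • (P * m) +
      (κ a * ν a * ρ b * stay a b (sin x) * stay a c (sin y) * perm b c (cos z)) • (Q * m) +
      (κ a * (ν b * ρ a * perm a b (cos x) * perm b c (cos y) * stay a b (sin z) +
        ν a * ρ b * stay a b (sin x) * perm a c (cos y) * perm b a (cos z))) • (P * (Q * m)) +
      (κ a * ν b * ρ a * perm a b (cos x) * stay b c (sin y) * perm a c (cos z)) •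
        (Q * (P * m)) +
      (κ a * (ν b * ρ a * perm a b (cos x) * perm b c (cos y) * perm a b (cos z) +
        ν a * ρ b * stay a b (sin x) * perm a c (cos y) * stay b a (sin z))) •
        (P * (Q * (P * m))) := by
  have hPm := H.coloured_P hm
  have hF := H.coloured_PQP hm
  have hPF := H.coloured_PQP hPm
  have hP (n : A) : P * (P * n) = n := by rw [← mul_assoc, H.P_sq, one_mul]
  have hB (n : A) : Q * (P * (Q * n)) = P * (Q * (P * n)) := by
    rw [← mul_assoc P Q n, ← mul_assoc Q, ← H.braid, mul_assoc, mul_assoc]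
  simp only [hP] at hPF
  have h1 := H.rmat13_mul hm y
  have h2 := H.rmat13_mul hPm y
  simp only [hP] at h2
  generalize Q * rmat P p₁ p₂ y * Q = Y at h1 h2
  simp only [mul_assoc, H.rmat12_mul hm, mul_smul_comm, mul_add, hL hm, hL hPm, h1, h2,
    hK hm, hN hm, hN hPm, hN hF, hN hPF, H.rmat23_mul hm, H.rmat23_mul hPm, H.rmat23_mul hF,
    H.rmat23_mul hPF, hB, hP]
  module

end ThreeSites

/-- `R₁₂(x) K R₁₃(y) L R₂₃(z) N` -/
def fwd (P Q p₁ p₂ p₃ : A) (K L N : A) (x y z : ℂ) : A :=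
  (rmat P p₁ p₂ x * K) * ((Q * rmat P p₁ p₂ y * Q) * L) * (rmat Q p₂ p₃ z * N)

/-- `R₂₃(z) N R₁₃(y) L R₁₂(x) K` -/
def bwd (P Q p₁ p₂ p₃ : A) (K L N : A) (x y z : ℂ) : A :=
  (rmat Q p₂ p₃ z * N) * ((Q * rmat P p₁ p₂ y * Q) * L) * (rmat P p₁ p₂ x * K)

/-- The parity operator of a projector. -/
def parity (p : A) : A := p - (1 - p)

/-! ### Three sites: Yang–Baxter relations with parity insertions. -/

namespace ThreeSites

variable {P Q p₁ p₂ p₃ : A}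

theorem one_mul_coloured {m : A} {a b c : ℂ} (_ : Coloured p₁ p₂ p₃ m a b c) :
    1 * m = ((fun _ => 1 : ℂ → ℂ) a) • m := by simp

theorem parity₁ {m : A} {a b c : ℂ} (hm : Coloured p₁ p₂ p₃ m a b c) :
    parity p₁ * m = ((fun t => 2 * t - 1 : ℂ → ℂ) a) • m := by
  simp only [parity, sub_mul, one_mul, hm.one]
  module

theorem parity₂ {m : A} {a b c : ℂ} (hm : Coloured p₁ p₂ p₃ m a b c) :
    parity p₂ * m = ((fun t => 2 * t - 1 : ℂ → ℂ) b) • m := by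
  simp only [parity, sub_mul, one_mul, hm.two]
  module

theorem one_mul_coloured₂ {m : A} {a b c : ℂ} (_ : Coloured p₁ p₂ p₃ m a b c) :
    1 * m = ((fun _ => 1 : ℂ → ℂ) b) • m := by simp

variable (H : ThreeSites P Q p₁ p₂ p₃)
include H

open Complex in
theorem yang_baxter_plain (x y z : ℂ) :
    fwd P Q p₁ p₂ p₃ 1 1 1 (x - y) (x - z) (y - z) =
      bwd P Q p₁ p₂ p₃ 1 1 1 (x - y) (x - z) (y - z) := by
  refine H.ext_coloured fun m a b c ha hb hc hm => ?_
  simp only [fwd, bwd]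
  rw [H.triple_mul one_mul_coloured one_mul_coloured one_mul_coloured₂ hm,
    H.triple_mul_rev one_mul_coloured one_mul_coloured one_mul_coloured₂ hm]
  simp only [sin_sub, cos_sub]
  have hx := sin_sq_add_cos_sq x
  have hy := sin_sq_add_cos_sq y
  have hz := sin_sq_add_cos_sq z
  generalize sin x = sx at *
  generalize sin y = sy at *
  generalize sin z = sz at *
  generalize cos x = cx at *
  generalize cos y = cy at *
  generalize cos z = cz at *
  -- For each colouring it suffices to match the coefficients of the permuted copies of `m`; these
  -- are polynomial identities modulo `sin² + cos² = 1`.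
  rcases ha with rfl | rfl <;> rcases hb with rfl | rfl <;> rcases hc with rfl | rfl <;>
    simp only [perm, stay, sub_self, sub_zero, mul_zero, mul_one, zero_mul, one_mul, add_zero,
      zero_add, zero_smul] <;> match_scalars <;> grind

open Complex in
/-- The decorated Yang–Baxter equation in which the third spectral parameter is reflected. -/
theorem yang_baxter_three (x y z : ℂ) :
    fwd P Q p₁ p₂ p₃ 1 (parity p₁) (parity p₂) (x - y) (x + z) (y + z) =
      bwd P Q p₁ p₂ p₃ 1 (parity p₁) (parity p₂) (x - y) (x + z) (y + z) := by
  refine H.ext_coloured fun m a b c ha hb hc hm => ?_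
  simp only [fwd, bwd]
  rw [H.triple_mul one_mul_coloured parity₁ parity₂ hm,
    H.triple_mul_rev one_mul_coloured parity₁ parity₂ hm]
  simp only [sin_add, cos_add, sin_sub, cos_sub]
  have hx := sin_sq_add_cos_sq x
  have hy := sin_sq_add_cos_sq y
  have hz := sin_sq_add_cos_sq z
  generalize sin x = sx at *
  generalize sin y = sy at *
  generalize sin z = sz at *
  generalize cos x = cx at *
  generalize cos y = cy at *
  generalize cos z = cz at *
  rcases ha with rfl | rfl <;> rcases hb with rfl | rfl <;> rcases hc with rfl | rfl <;>
    simp only [perm, stay, sub_self, sub_zero, mul_zero, mul_one, zero_mul, one_mul, add_zero,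
      zero_add, zero_smul] <;> match_scalars <;> grind

open Complex in
-- The parities sit on the two matrices involving particle 2, whose parameter enters with the
-- opposite sign.
theorem yang_baxter_two (x y z : ℂ) :
    fwd P Q p₁ p₂ p₃ (parity p₁) 1 (parity p₂) (x + y) (x - z) (y + z) =
      bwd P Q p₁ p₂ p₃ (parity p₁) 1 (parity p₂) (x + y) (x - z) (y + z) := by
  refine H.ext_coloured fun m a b c ha hb hc hm => ?_
  simp only [fwd, bwd]
  rw [H.triple_mul parity₁ one_mul_coloured parity₂ hm,
    H.triple_mul_rev parity₁ one_mul_coloured parity₂ hm]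
  simp only [sin_add, cos_add, sin_sub, cos_sub]
  have hx := sin_sq_add_cos_sq x
  have hy := sin_sq_add_cos_sq y
  have hz := sin_sq_add_cos_sq z
  generalize sin x = sx at *
  generalize sin y = sy at *
  generalize sin z = sz at *
  generalize cos x = cx at *
  generalize cos y = cy at *
  generalize cos z = cz at *
  rcases ha with rfl | rfl <;> rcases hb with rfl | rfl <;> rcases hc with rfl | rfl <;>
    simp only [perm, stay, sub_self, sub_zero, mul_zero, mul_one, zero_mul, one_mul, add_zero,
      zero_add, zero_smul] <;> match_scalars <;> grind

open Complex in
theorem yang_baxter_one (x y z : ℂ) :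
    fwd P Q p₁ p₂ p₃ (parity p₁) (parity p₁) 1 (x + y) (x + z) (y - z) =
      bwd P Q p₁ p₂ p₃ (parity p₁) (parity p₁) 1 (x + y) (x + z) (y - z) := by
  refine H.ext_coloured fun m a b c ha hb hc hm => ?_
  simp only [fwd, bwd]
  rw [H.triple_mul parity₁ parity₁ one_mul_coloured₂ hm,
    H.triple_mul_rev parity₁ parity₁ one_mul_coloured₂ hm]
  simp only [sin_add, cos_add, sin_sub, cos_sub]
  have hx := sin_sq_add_cos_sq x
  have hy := sin_sq_add_cos_sq y
  have hz := sin_sq_add_cos_sq z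
  generalize sin x = sx at *
  generalize sin y = sy at *
  generalize sin z = sz at *
  generalize cos x = cx at *
  generalize cos y = cy at *
  generalize cos z = cz at *
  rcases ha with rfl | rfl <;> rcases hb with rfl | rfl <;> rcases hc with rfl | rfl <;>
    simp only [perm, stay, sub_self, sub_zero, mul_zero, mul_one, zero_mul, one_mul, add_zero,
      zero_add, zero_smul] <;> match_scalars <;> grind

open Complex in
/-- The forward and backward products with an odd number of parity insertions all have the same
difference, up to sign. -/
theorem difference_one_three (x y z : ℂ) :
    fwd P Q p₁ p₂ p₃ (parity p₁) 1 1 (x + y) (x - z) (y - z) -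
      bwd P Q p₁ p₂ p₃ (parity p₁) 1 1 (x + y) (x - z) (y - z) =
    -(fwd P Q p₁ p₂ p₃ 1 (parity p₁) 1 (x - y) (x + z) (y - z) -
      bwd P Q p₁ p₂ p₃ 1 (parity p₁) 1 (x - y) (x + z) (y - z)) := by
  refine H.ext_coloured fun m a b c ha hb hc hm => ?_
  simp only [sub_mul, neg_mul, fwd, bwd]
  rw [H.triple_mul parity₁ one_mul_coloured one_mul_coloured₂ hm,
    H.triple_mul_rev parity₁ one_mul_coloured one_mul_coloured₂ hm,
    H.triple_mul one_mul_coloured parity₁ one_mul_coloured₂ hm,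
    H.triple_mul_rev one_mul_coloured parity₁ one_mul_coloured₂ hm]
  simp only [sin_add, cos_add, sin_sub, cos_sub]
  have hx := sin_sq_add_cos_sq x
  have hy := sin_sq_add_cos_sq y
  have hz := sin_sq_add_cos_sq z
  generalize sin x = sx at *
  generalize sin y = sy at *
  generalize sin z = sz at *
  generalize cos x = cx at *
  generalize cos y = cy at *
  generalize cos z = cz at *
  rcases ha with rfl | rfl <;> rcases hb with rfl | rfl <;> rcases hc with rfl | rfl <;>
    simp only [perm, stay, sub_self, sub_zero, mul_zero, mul_one, zero_mul, one_mul, add_zero,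
      zero_add, zero_smul] <;> match_scalars <;> grind

open Complex in
theorem difference_two_three (x y z : ℂ) :
    fwd P Q p₁ p₂ p₃ (parity p₁) 1 1 (x + y) (x - z) (y - z) -
      bwd P Q p₁ p₂ p₃ (parity p₁) 1 1 (x + y) (x - z) (y - z) =
    fwd P Q p₁ p₂ p₃ 1 1 (parity p₂) (x - y) (x - z) (y + z) -
      bwd P Q p₁ p₂ p₃ 1 1 (parity p₂) (x - y) (x - z) (y + z) := by
  refine H.ext_coloured fun m a b c ha hb hc hm => ?_
  simp only [sub_mul, fwd, bwd]
  rw [H.triple_mul parity₁ one_mul_coloured one_mul_coloured₂ hm,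
    H.triple_mul_rev parity₁ one_mul_coloured one_mul_coloured₂ hm,
    H.triple_mul one_mul_coloured one_mul_coloured parity₂ hm,
    H.triple_mul_rev one_mul_coloured one_mul_coloured parity₂ hm]
  simp only [sin_add, cos_add, sin_sub, cos_sub]
  have hx := sin_sq_add_cos_sq x
  have hy := sin_sq_add_cos_sq y
  have hz := sin_sq_add_cos_sq z
  generalize sin x = sx at *
  generalize sin y = sy at *
  generalize sin z = sz at *
  generalize cos x = cx at *
  generalize cos y = cy at *
  generalize cos z = cz at *
  rcases ha with rfl | rfl <;> rcases hb with rfl | rfl <;> rcases hc with rfl | rfl <;>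
    simp only [perm, stay, sub_self, sub_zero, mul_zero, mul_one, zero_mul, one_mul, add_zero,
      zero_add, zero_smul] <;> match_scalars <;> grind

open Complex in
theorem difference_all (x y z : ℂ) :
    fwd P Q p₁ p₂ p₃ (parity p₁) 1 1 (x + y) (x - z) (y - z) -
      bwd P Q p₁ p₂ p₃ (parity p₁) 1 1 (x + y) (x - z) (y - z) =
    -(fwd P Q p₁ p₂ p₃ (parity p₁) (parity p₁) (parity p₂) (x + y) (x + z) (y + z) -
      bwd P Q p₁ p₂ p₃ (parity p₁) (parity p₁) (parity p₂) (x + y) (x + z) (y + z)) := by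
  refine H.ext_coloured fun m a b c ha hb hc hm => ?_
  simp only [sub_mul, neg_mul, fwd, bwd]
  rw [H.triple_mul parity₁ one_mul_coloured one_mul_coloured₂ hm,
    H.triple_mul_rev parity₁ one_mul_coloured one_mul_coloured₂ hm,
    H.triple_mul parity₁ parity₁ parity₂ hm,
    H.triple_mul_rev parity₁ parity₁ parity₂ hm]
  simp only [sin_add, cos_add, sin_sub, cos_sub]
  have hx := sin_sq_add_cos_sq x
  have hy := sin_sq_add_cos_sq y
  have hz := sin_sq_add_cos_sq z
  generalize sin x = sx at *
  generalize sin y = sy at *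
  generalize sin z = sz at *
  generalize cos x = cx at *
  generalize cos y = cy at *
  generalize cos z = cz at *
  rcases ha with rfl | rfl <;> rcases hb with rfl | rfl <;> rcases hc with rfl | rfl <;>
    simp only [perm, stay, sub_self, sub_zero, mul_zero, mul_one, zero_mul, one_mul, add_zero,
      zero_add, zero_smul] <;> match_scalars <;> grind

open Complex in
/-- The linear relation between the odd products that multiplies the coefficient `U`. -/
theorem sum_eq_zero (x y z : ℂ) :
    (sin (x - y) * cos (x - y)) • (fwd P Q p₁ p₂ p₃ (parity p₁) 1 1 (x + y) (x - z) (y - z) +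
        bwd P Q p₁ p₂ p₃ (parity p₁) 1 1 (x + y) (x - z) (y - z)) -
      (sin (x - z) * cos (x - z)) • (fwd P Q p₁ p₂ p₃ 1 (parity p₁) 1 (x - y) (x + z) (y - z) +
        bwd P Q p₁ p₂ p₃ 1 (parity p₁) 1 (x - y) (x + z) (y - z)) +
      (sin (y - z) * cos (y - z)) • (fwd P Q p₁ p₂ p₃ 1 1 (parity p₂) (x - y) (x - z) (y + z) +
        bwd P Q p₁ p₂ p₃ 1 1 (parity p₂) (x - y) (x - z) (y + z)) = 0 := by
  refine H.ext_coloured fun m a b c ha hb hc hm => ?_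
  simp only [add_mul, sub_mul, smul_mul_assoc, zero_mul, fwd, bwd]
  rw [H.triple_mul parity₁ one_mul_coloured one_mul_coloured₂ hm,
    H.triple_mul_rev parity₁ one_mul_coloured one_mul_coloured₂ hm,
    H.triple_mul one_mul_coloured parity₁ one_mul_coloured₂ hm,
    H.triple_mul_rev one_mul_coloured parity₁ one_mul_coloured₂ hm,
    H.triple_mul one_mul_coloured one_mul_coloured parity₂ hm,
    H.triple_mul_rev one_mul_coloured one_mul_coloured parity₂ hm]
  simp only [sin_add, cos_add, sin_sub, cos_sub]
  have hx := sin_sq_add_cos_sq x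
  have hy := sin_sq_add_cos_sq y
  have hz := sin_sq_add_cos_sq z
  generalize sin x = sx at *
  generalize sin y = sy at *
  generalize sin z = sz at *
  generalize cos x = cx at *
  generalize cos y = cy at *
  generalize cos z = cz at *
  rcases ha with rfl | rfl <;> rcases hb with rfl | rfl <;> rcases hc with rfl | rfl <;>
    simp only [perm, stay, sub_self, sub_zero, mul_zero, mul_one, zero_mul, one_mul, add_zero,
      zero_add, zero_smul] <;> match_scalars <;> grind

open Complex in
/-- The linear relation between the odd products that multiplies the product of the three
couplings. -/
theorem sum_eq_zero_all (x y z : ℂ) :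
    (sin (x - y) * (sin (x + z) * sin (y + z))) •
        (fwd P Q p₁ p₂ p₃ (parity p₁) 1 1 (x + y) (x - z) (y - z) +
        bwd P Q p₁ p₂ p₃ (parity p₁) 1 1 (x + y) (x - z) (y - z)) -
      (sin (x - z) * (sin (x + y) * sin (y + z))) •
        (fwd P Q p₁ p₂ p₃ 1 (parity p₁) 1 (x - y) (x + z) (y - z) +
        bwd P Q p₁ p₂ p₃ 1 (parity p₁) 1 (x - y) (x + z) (y - z)) +
      (sin (y - z) * (sin (x + y) * sin (x + z))) •
        (fwd P Q p₁ p₂ p₃ 1 1 (parity p₂) (x - y) (x - z) (y + z) +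
        bwd P Q p₁ p₂ p₃ 1 1 (parity p₂) (x - y) (x - z) (y + z)) -
      (sin (x - y) * sin (x - z) * sin (y - z)) •
        (fwd P Q p₁ p₂ p₃ (parity p₁) (parity p₁) (parity p₂) (x + y) (x + z) (y + z) +
        bwd P Q p₁ p₂ p₃ (parity p₁) (parity p₁) (parity p₂) (x + y) (x + z) (y + z)) = 0 := by
  refine H.ext_coloured fun m a b c ha hb hc hm => ?_
  simp only [add_mul, sub_mul, smul_mul_assoc, zero_mul, fwd, bwd]
  rw [H.triple_mul parity₁ one_mul_coloured one_mul_coloured₂ hm,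
    H.triple_mul_rev parity₁ one_mul_coloured one_mul_coloured₂ hm,
    H.triple_mul one_mul_coloured parity₁ one_mul_coloured₂ hm,
    H.triple_mul_rev one_mul_coloured parity₁ one_mul_coloured₂ hm,
    H.triple_mul one_mul_coloured one_mul_coloured parity₂ hm,
    H.triple_mul_rev one_mul_coloured one_mul_coloured parity₂ hm,
    H.triple_mul parity₁ parity₁ parity₂ hm,
    H.triple_mul_rev parity₁ parity₁ parity₂ hm]
  simp only [sin_add, cos_add, sin_sub, cos_sub]
  have hx := sin_sq_add_cos_sq x
  have hy := sin_sq_add_cos_sq y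
  have hz := sin_sq_add_cos_sq z
  generalize sin x = sx at *
  generalize sin y = sy at *
  generalize sin z = sz at *
  generalize cos x = cx at *
  generalize cos y = cy at *
  generalize cos z = cz at *
  rcases ha with rfl | rfl <;> rcases hb with rfl | rfl <;> rcases hc with rfl | rfl <;>
    simp only [perm, stay, sub_self, sub_zero, mul_zero, mul_one, zero_mul, one_mul, add_zero,
      zero_add, zero_smul] <;> match_scalars <;> grind

end ThreeSites

/-- The relations between the permutation and the projectors on two sites. -/
structure TwoSites (P p q : A) : Prop where
  sq : P * P = 1
  swap : P * p = q * P
  comm : p * q = q * p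
  idem_left : p * p = p
  idem_right : q * q = q

/-! ### Two sites: the product relations behind unitarity. -/

namespace TwoSites

variable {P p q : A} (H : TwoSites P p q)
include H

theorem ext_coloured {X Y : A}
    (h : ∀ (m : A) (a b : ℂ), a = 0 ∨ a = 1 → b = 0 ∨ b = 1 → p * m = a • m → q * m = b • m →
      X * m = Y * m) : X = Y := by
  have key := mul_eq_mul_of_eigenvectors (X := X) (Y := Y) H.idem_left (fun _ => True)
    (fun _ _ => ⟨trivial, trivial⟩)
    (fun a ha m _ hm => mul_eq_mul_of_eigenvectors H.idem_right (fun m => p * m = a • m)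
      (fun m hm => mul_eigenvector H.comm hm)
      (fun b hb m hm hm' => h m a b ha hb hm hm') m hm) 1 trivial
  simpa using key

variable {m : A} {a b : ℂ}

theorem left_mul (hb : q * m = b • m) : p * (P * m) = b • (P * m) :=
  swap_eigenvector (swap_symm H.sq H.swap) hb

theorem right_mul (ha : p * m = a • m) : q * (P * m) = a • (P * m) :=
  swap_eigenvector H.swap ha

theorem rmat_mul_of_eigenvector (ha : p * m = a • m) (hb : q * m = b • m) (l : ℂ) :
    rmat P p q l * m =
      perm a b (Complex.cos l) • (P * m) + stay a b (Complex.sin l) • m :=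
  rmat_mul ha hb (H.left_mul hb) (H.right_mul ha) l

omit [Algebra ℂ A] in
theorem permutation_permutation (m : A) : P * (P * m) = m := by
  rw [← mul_assoc, H.sq, one_mul]

theorem conj_rmat (l : ℂ) : P * rmat P p q l * P = rmat P p q l := by
  refine H.ext_coloured fun m a b ha hb hp hq => ?_
  rw [mul_assoc, mul_assoc, H.rmat_mul_of_eigenvector (H.left_mul hq) (H.right_mul hp),
    H.rmat_mul_of_eigenvector hp hq]
  simp only [mul_add, mul_smul_comm, H.permutation_permutation, perm, stay]
  module

theorem conj_rmat_parity (l : ℂ) :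
    P * (rmat P p q l * parity p) * P = rmat P p q l * parity q := by
  have h : parity p * P = P * parity q := by
    simp only [parity, sub_mul, mul_sub, one_mul, mul_one, swap_symm H.sq H.swap]
  rw [mul_assoc, mul_assoc, h, ← mul_assoc _ P, ← mul_assoc P, ← mul_assoc P, H.conj_rmat]

omit H in
theorem parity_mul (ha : p * m = a • m) : parity p * m = (2 * a - 1) • m := by
  simp only [parity, sub_mul, one_mul, ha]
  module

open Complex in
theorem rmat_mul_rmat_neg (x : ℂ) :
    rmat P p q x * rmat P p q (-x) = (cos x ^ 2) • (1 : A) := by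
  refine H.ext_coloured fun m a b ha hb hp hq => ?_
  have h := cos_sq_add_sin_sq x
  simp only [mul_assoc, H.rmat_mul_of_eigenvector hp hq, mul_add, mul_smul_comm,
    H.rmat_mul_of_eigenvector (H.left_mul hq) (H.right_mul hp), H.permutation_permutation,
    cos_neg, sin_neg, smul_mul_assoc, one_mul]
  rcases ha with rfl | rfl <;> rcases hb with rfl | rfl <;> simp only [perm, stay] <;>
    match_scalars <;> grind

open Complex in
-- On different colours the parity has opposite signs on `m` and `P * m`, so the product becomes `(P
-- + sin x)(P - sin x) = cos² x`.
theorem rmat_parity_mul_rmat_parity (x : ℂ) :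
    rmat P p q x * parity p * (rmat P p q x * parity q) = (cos x ^ 2) • (1 : A) := by
  refine H.ext_coloured fun m a b ha hb hp hq => ?_
  have h := cos_sq_add_sin_sq x
  simp only [mul_assoc, parity_mul hq, H.rmat_mul_of_eigenvector hp hq, mul_add, mul_smul_comm,
    parity_mul hp, parity_mul (H.left_mul hq),
    H.rmat_mul_of_eigenvector (H.left_mul hq) (H.right_mul hp), H.permutation_permutation,
    smul_mul_assoc, one_mul]
  rcases ha with rfl | rfl <;> rcases hb with rfl | rfl <;> simp only [perm, stay] <;>
    match_scalars <;> grind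

open Complex in
-- This equates the two cross terms in unitarity. On different colours, moving the parity past
-- `R(-x)` turns `P - sin x` into `P + sin x` up to a common sign, and the two factors commute.
theorem rmat_mul_rmat_parity (x y : ℂ) :
    rmat P p q x * (rmat P p q y * parity q) = rmat P p q y * parity p * rmat P p q (-x) := by
  refine H.ext_coloured fun m a b ha hb hp hq => ?_
  simp only [mul_assoc, parity_mul hq, H.rmat_mul_of_eigenvector hp hq, mul_add, mul_smul_comm,
    parity_mul hp, parity_mul (H.left_mul hq),
    H.rmat_mul_of_eigenvector (H.left_mul hq) (H.right_mul hp), H.permutation_permutation,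
    cos_neg, sin_neg]
  rcases ha with rfl | rfl <;> rcases hb with rfl | rfl <;> simp only [perm, stay] <;>
    match_scalars <;> grind

end TwoSites

end Algebra

/-! ### The graded permutation and the leg embeddings satisfy the abstract relations. -/

section Legs

variable {V : Type*} [AddCommGroup V] [Module ℂ V]

theorem op1_mul (X Y : Module.End ℂ V) : op1 (X * Y) = op1 X * op1 Y := by
  ext; simp [op1]

theorem op2_mul (X Y : Module.End ℂ V) : op2 (X * Y) = op2 X * op2 Y := by
  ext; simp [op2]

theorem op1_mul_op2 (X Y : Module.End ℂ V) : op1 X * op2 Y = op2 Y * op1 X := by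
  ext; simp [op1, op2]

theorem op1_sub (X Y : Module.End ℂ V) : op1 (X - Y) = op1 X - op1 Y := by
  ext; simp [op1, TensorProduct.sub_tmul]

theorem op2_sub (X Y : Module.End ℂ V) : op2 (X - Y) = op2 X - op2 Y := by
  ext; simp [op2, TensorProduct.tmul_sub]

theorem op1_one : op1 (1 : Module.End ℂ V) = 1 := by ext; simp [op1]

theorem op2_one : op2 (1 : Module.End ℂ V) = 1 := by ext; simp [op2]

theorem op1_C (π : Module.End ℂ V) : op1 (C π) = parity (op1 π) := by
  simp only [C, parity, op1_sub, op1_one]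

variable (V) in
/-- `leg12` as an algebra homomorphism. -/
def leg12Hom : Module.End ℂ (V ⊗[ℂ] V) →ₐ[ℂ] Module.End ℂ (V ⊗[ℂ] V ⊗[ℂ] V) :=
  AlgHom.ofLinearMap (LinearMap.rTensorHom V) (LinearMap.rTensor_id V _)
    (fun X Y => LinearMap.rTensor_mul V X Y)

variable (V) in
/-- `leg23` as an algebra homomorphism. -/
def leg23Hom : Module.End ℂ (V ⊗[ℂ] V) →ₐ[ℂ] Module.End ℂ (V ⊗[ℂ] V ⊗[ℂ] V) :=
  AlgHom.ofLinearMap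
    ((TensorProduct.assoc ℂ V V V).symm.conj.toLinearMap ∘ₗ LinearMap.lTensorHom V)
    (by ext; simp [LinearEquiv.conj_apply])
    (fun X Y => by ext; simp [LinearEquiv.conj_apply])

theorem leg12Hom_apply (X : Module.End ℂ (V ⊗[ℂ] V)) : leg12Hom V X = leg12 X := rfl

theorem leg23Hom_apply (X : Module.End ℂ (V ⊗[ℂ] V)) : leg23Hom V X = leg23 X := rfl

theorem map_rmat {A B : Type*} [Ring A] [Algebra ℂ A] [Ring B] [Algebra ℂ B] (f : A →ₐ[ℂ] B)
    (P p q : A) (l : ℂ) : f (rmat P p q l) = rmat (f P) (f p) (f q) l := by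
  simp only [rmat, map_add, map_mul, map_sub, map_smul, map_one]

theorem map_parity {A B : Type*} [Ring A] [Algebra ℂ A] [Ring B] [Algebra ℂ B] (f : A →ₐ[ℂ] B)
    (p : A) : f (parity p) = parity (f p) := by
  simp only [parity, map_sub, map_one]

theorem leg12_tmul (X : Module.End ℂ (V ⊗[ℂ] V)) (t : V ⊗[ℂ] V) (w : V) :
    leg12 X (t ⊗ₜ w) = X t ⊗ₜ w := rfl

theorem leg23_tmul (X : Module.End ℂ (V ⊗[ℂ] V)) (u v w : V) :
    leg23 X (u ⊗ₜ v ⊗ₜ w) = (TensorProduct.assoc ℂ V V V).symm (u ⊗ₜ X (v ⊗ₜ w)) := rfl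

theorem leg23_op1 (X : Module.End ℂ V) : leg23 (op1 X) = leg12 (op2 X) := by
  ext; simp [leg23, leg12, op1, op2]

theorem leg12_op1_commute (X : Module.End ℂ V) (Y : Module.End ℂ (V ⊗[ℂ] V)) :
    leg12 (op1 X) * leg23 Y = leg23 Y * leg12 (op1 X) := by
  ext u v w
  simp only [TensorProduct.AlgebraTensorModule.curry_apply, LinearMap.restrictScalars_self,
    TensorProduct.curry_apply, Module.End.mul_apply, leg12_tmul, leg23_tmul, op1,
    TensorProduct.map_tmul, Module.End.one_apply]
  induction Y (v ⊗ₜ w) with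
  | zero => simp
  | tmul s t => simp [leg12_tmul]
  | add s t hs ht => simp only [TensorProduct.tmul_add, map_add, hs, ht]

theorem leg23_op2_commute (X : Module.End ℂ V) (Y : Module.End ℂ (V ⊗[ℂ] V)) :
    leg12 Y * leg23 (op2 X) = leg23 (op2 X) * leg12 Y := by
  ext u v w
  simp only [TensorProduct.AlgebraTensorModule.curry_apply, LinearMap.restrictScalars_self,
    TensorProduct.curry_apply, Module.End.mul_apply, leg12_tmul, leg23_tmul, op2,
    TensorProduct.map_tmul, Module.End.one_apply, TensorProduct.assoc_symm_tmul]
  induction Y (u ⊗ₜ v) with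
  | zero => simp
  | tmul s t => simp [leg23_tmul]
  | add s t hs ht => simp only [TensorProduct.add_tmul, map_add, ← hs, ← ht]

variable (𝒱 : ZMod 2 → Submodule ℂ V) [DirectSum.Decomposition 𝒱]

theorem linearMap_ext_homogeneous {M : Type*} [AddCommGroup M] [Module ℂ M] {f g : V →ₗ[ℂ] M}
    (h : ∀ i, ∀ v ∈ 𝒱 i, f v = g v) : f = g := by
  ext v
  induction v using DirectSum.Decomposition.inductionOn 𝒱 with
  | zero => simp
  | homogeneous v => exact h _ v v.2
  | add u v hu hv => rw [map_add, map_add, hu, hv]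

theorem P_mul_P : P 𝒱 * P 𝒱 = 1 := by
  refine TensorProduct.ext (linearMap_ext_homogeneous 𝒱 fun i u hu =>
    linearMap_ext_homogeneous 𝒱 fun j v hv => ?_)
  simp only [LinearMap.compr₂ₛₗ_apply, TensorProduct.mk_apply, Module.End.mul_apply,
    P_tmul 𝒱 hu hv, map_smul, P_tmul 𝒱 hv hu, smul_smul, Module.End.one_apply]
  rw [mul_comm j.val, ← pow_add, Even.neg_one_pow ⟨_, rfl⟩, one_smul]

theorem P_mul_op1 {π : Module.End ℂ V} (hπ : ∀ i, ∀ v ∈ 𝒱 i, π v ∈ 𝒱 i) :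
    P 𝒱 * op1 π = op2 π * P 𝒱 := by
  refine TensorProduct.ext (linearMap_ext_homogeneous 𝒱 fun i u hu =>
    linearMap_ext_homogeneous 𝒱 fun j v hv => ?_)
  simp only [LinearMap.compr₂ₛₗ_apply, TensorProduct.mk_apply, Module.End.mul_apply, op1, op2,
    TensorProduct.map_tmul, Module.End.one_apply, P_tmul 𝒱 hu hv, map_smul,
    P_tmul 𝒱 (hπ i u hu) hv]

/-- Both sides reverse three homogeneous vectors, with the same sign `(-1)^(ij + ik + jk)`. -/
theorem P_braid :
    leg12 (P 𝒱) * (leg23 (P 𝒱) * leg12 (P 𝒱)) = leg23 (P 𝒱) * (leg12 (P 𝒱) * leg23 (P 𝒱)) := by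
  refine TensorProduct.ext (TensorProduct.ext (linearMap_ext_homogeneous 𝒱 fun i u hu =>
    linearMap_ext_homogeneous 𝒱 fun j v hv => linearMap_ext_homogeneous 𝒱 fun k w hw => ?_))
  simp only [LinearMap.compr₂ₛₗ_apply, TensorProduct.mk_apply, Module.End.mul_apply,
    leg12_tmul, leg23_tmul, P_tmul 𝒱 hu hv, P_tmul 𝒱 hu hw, P_tmul 𝒱 hv hw,
    ← TensorProduct.smul_tmul', TensorProduct.tmul_smul, map_smul, TensorProduct.assoc_symm_tmul,
    smul_smul]
  ring_nf

variable {π : Module.End ℂ V} (hπ : IsIdempotentElem π) (heven : ∀ i, ∀ v ∈ 𝒱 i, π v ∈ 𝒱 i)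
include hπ heven

theorem twoSites : TwoSites (P 𝒱) (op1 π) (op2 π) where
  sq := P_mul_P 𝒱
  swap := P_mul_op1 𝒱 heven
  comm := op1_mul_op2 π π
  idem_left := by rw [← op1_mul, hπ.eq]
  idem_right := by rw [← op2_mul, hπ.eq]

theorem threeSites : ThreeSites (leg12 (P 𝒱)) (leg23 (P 𝒱)) (leg12 (op1 π)) (leg12 (op2 π))
    (leg23 (op2 π)) where
  P_sq := by simp only [← leg12Hom_apply, ← map_mul, P_mul_P, map_one]
  Q_sq := by simp only [← leg23Hom_apply, ← map_mul, P_mul_P, map_one]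
  braid := P_braid 𝒱
  P_one := by simp only [← leg12Hom_apply, ← map_mul, P_mul_op1 𝒱 heven]
  P_three := leg23_op2_commute π _
  Q_one := (leg12_op1_commute π _).symm
  Q_two := by simp only [← leg23_op1, ← leg23Hom_apply, ← map_mul, P_mul_op1 𝒱 heven]
  comm_one_two := by simp only [← leg12Hom_apply, ← map_mul, op1_mul_op2]
  comm_one_three := leg12_op1_commute π _
  comm_two_three := leg23_op2_commute π _
  idem_one := by simp only [← leg12Hom_apply, ← map_mul, ← op1_mul, hπ.eq]
  idem_two := by simp only [← leg12Hom_apply, ← map_mul, ← op2_mul, hπ.eq]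
  idem_three := by simp only [← leg23Hom_apply, ← map_mul, ← op2_mul, hπ.eq]

end Legs

/-! ### Hyperbolic identities for the coupling. -/

section Scalars

variable {U : ℂ} {h : ℂ → ℂ} (hh : ∀ l : ℂ, Complex.sinh (2 * h l) = U * Complex.sin (2 * l))
include hh

open Complex in
-- Half the sum of the constraints at `x` and `y`, by the sum-to-product formulas.
theorem sinh_add_mul_cosh_sub (x y : ℂ) :
    sinh (h x + h y) * cosh (h x - h y) = U * (sin (x + y) * cos (x - y)) := by
  have hx := hh x
  have hy := hh y
  rw [sinh_two_mul, sin_two_mul] at hx hy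
  rw [sinh_add, cosh_sub, sin_add, cos_sub]
  have h1 := cosh_sq_sub_sinh_sq (h x)
  have h2 := cosh_sq_sub_sinh_sq (h y)
  have h3 := sin_sq_add_cos_sq x
  have h4 := sin_sq_add_cos_sq y
  linear_combination hx / 2 + hy / 2 + cosh (h x) * sinh (h x) * h2 + cosh (h y) * sinh (h y) * h1 -
    U * sin x * cos x * h4 - U * sin y * cos y * h3

open Complex in
theorem sinh_sub_mul_cosh_add (x y : ℂ) :
    sinh (h x - h y) * cosh (h x + h y) = U * (sin (x - y) * cos (x + y)) := by
  have hx := hh x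
  have hy := hh y
  rw [sinh_two_mul, sin_two_mul] at hx hy
  rw [sinh_sub, cosh_add, sin_sub, cos_add]
  have h1 := cosh_sq_sub_sinh_sq (h x)
  have h2 := cosh_sq_sub_sinh_sq (h y)
  have h3 := sin_sq_add_cos_sq x
  have h4 := sin_sq_add_cos_sq y
  linear_combination hx / 2 - hy / 2 + cosh (h x) * sinh (h x) * h2 - cosh (h y) * sinh (h y) * h1 -
    U * sin x * cos x * h4 + U * sin y * cos y * h3

open Complex in
/-- The three couplings and their product depend linearly on two parameters. -/
theorem exists_coupling_eq {x y z : ℂ} (hxy : sin (x + y) ≠ 0) (hxz : sin (x + z) ≠ 0)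
    (hyz : sin (y + z) ≠ 0) (hxy' : cosh (h x + h y) ≠ 0) (hxz' : cosh (h x + h z) ≠ 0)
    (hyz' : cosh (h y + h z) ≠ 0) :
    ∃ k t : ℂ,
      coupling h x y =
        k * (sin (x - y) * cos (x - y)) + t * (sin (x - y) * (sin (x + z) * sin (y + z))) ∧
      coupling h x z =
        k * (sin (x - z) * cos (x - z)) + t * (sin (x - z) * (sin (x + y) * sin (y + z))) ∧
      coupling h y z =
        k * (sin (y - z) * cos (y - z)) + t * (sin (y - z) * (sin (x + y) * sin (x + z))) ∧
      coupling h x y * coupling h x z * coupling h y z =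
        t * (sin (x - y) * sin (x - z) * sin (y - z)) := by
  have h1 := sinh_add_mul_cosh_sub hh x y
  have h2 := sinh_add_mul_cosh_sub hh x z
  have h3 := sinh_add_mul_cosh_sub hh y z
  -- Writing each difference through the other two sums yields `tanh h'₁₂ (1 - tanh h'₁₃ tanh h'₂₃)`
  -- after division by the three `cosh`. The term free of `U` is the product of all three `tanh`,
  -- common to the three equations; this dictates `k` and `t`.
  rw [show h x - h y = (h x + h z) - (h y + h z) by ring, cosh_sub] at h1
  rw [show h x - h z = (h x + h y) - (h y + h z) by ring, cosh_sub] at h2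
  rw [show h y - h z = (h x + h y) - (h x + h z) by ring, cosh_sub] at h3
  refine ⟨U / (cosh (h x + h y) * cosh (h x + h z) * cosh (h y + h z)),
    tanh (h x + h y) * tanh (h x + h z) * tanh (h y + h z) /
      (sin (x + y) * sin (x + z) * sin (y + z)), ?_, ?_, ?_, ?_⟩ <;>
    simp only [coupling, tanh_eq_sinh_div_cosh] <;> field_simp
  · linear_combination sin (x - y) * h1
  · linear_combination sin (x - z) * h2
  · linear_combination sin (y - z) * h3

open Complex in
-- Eliminates `U` between the two product formulas.
theorem coupling_mul_cos {x y : ℂ} (hs : sin (x + y) ≠ 0) (hc : cosh (h x + h y) ≠ 0)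
    (hc' : cosh (h x - h y) ≠ 0) :
    sin (x - y) / sin (x + y) * tanh (h x + h y) * cos (x + y) =
      tanh (h x - h y) * cos (x - y) := by
  have h1 := sinh_add_mul_cosh_sub hh x y
  have h2 := sinh_sub_mul_cosh_add hh x y
  rw [tanh_eq_sinh_div_cosh, tanh_eq_sinh_div_cosh]
  field_simp
  linear_combination sin (x - y) * cos (x + y) * h1 - sin (x + y) * cos (x - y) * h2

end Scalars

/-! ### Joining the two species. -/

theorem coupling_swap (h : ℂ → ℂ) (x y : ℂ) : coupling h y x = -coupling h x y := by
  rw [coupling, coupling, ← neg_sub x y, Complex.sin_neg, add_comm y, add_comm (h y)]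
  ring

theorem conj_mul_parity {A : Type*} [Ring A] {p Q : A} (h : p * Q = Q * p) (R : A) :
    Q * (R * parity p) * Q = Q * R * Q * parity p := by
  simp only [parity, mul_assoc, sub_mul, mul_sub, mul_one, h]

/-- If the differences `Tᵢ - Sᵢ` agree up to alternating signs and the signed sums `Tᵢ + Sᵢ` cancel,
then `∑ cᵢ Tᵢ ⊗ Tᵢ'` is invariant under exchanging `T` and `S`. -/
theorem bilinear_sum_eq {A B M : Type*} [AddCommGroup A] [Module ℂ A] [AddCommGroup B]
    [Module ℂ B] [AddCommGroup M] [Module ℂ M] (f : A →ₗ[ℂ] B →ₗ[ℂ] M)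
    {T₁ T₂ T₃ T₄ S₁ S₂ S₃ S₄ : A} {T₁' T₂' T₃' T₄' S₁' S₂' S₃' S₄' : B} {c₁ c₂ c₃ c₄ : ℂ}
    (h₂ : T₁ - S₁ = -(T₂ - S₂)) (h₃ : T₁ - S₁ = T₃ - S₃) (h₄ : T₁ - S₁ = -(T₄ - S₄))
    (h₂' : T₁' - S₁' = -(T₂' - S₂')) (h₃' : T₁' - S₁' = T₃' - S₃')
    (h₄' : T₁' - S₁' = -(T₄' - S₄'))
    (hs : c₁ • (T₁ + S₁) - c₂ • (T₂ + S₂) + c₃ • (T₃ + S₃) - c₄ • (T₄ + S₄) = 0)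
    (hs' : c₁ • (T₁' + S₁') - c₂ • (T₂' + S₂') + c₃ • (T₃' + S₃') - c₄ • (T₄' + S₄') = 0) :
    c₁ • f T₁ T₁' + c₂ • f T₂ T₂' + c₃ • f T₃ T₃' + c₄ • f T₄ T₄' =
      c₁ • f S₁ S₁' + c₂ • f S₂ S₂' + c₃ • f S₃ S₃' + c₄ • f S₄ S₄' := by
  obtain ⟨D, hD⟩ : ∃ D, T₁ - S₁ = D := ⟨_, rfl⟩
  obtain ⟨D', hD'⟩ : ∃ D, T₁' - S₁' = D := ⟨_, rfl⟩
  rw [hD] at h₂ h₃ h₄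
  rw [hD'] at h₂' h₃' h₄'
  obtain rfl : T₁ = S₁ + D := by rw [← hD]; abel
  obtain rfl : T₂ = S₂ - D := by rw [h₂]; abel
  obtain rfl : T₃ = S₃ + D := by rw [h₃]; abel
  obtain rfl : T₄ = S₄ - D := by rw [h₄]; abel
  obtain rfl : T₁' = S₁' + D' := by rw [← hD']; abel
  obtain rfl : T₂' = S₂' - D' := by rw [h₂']; abel
  obtain rfl : T₃' = S₃' + D' := by rw [h₃']; abel
  obtain rfl : T₄' = S₄' - D' := by rw [h₄']; abel
  -- By polarisation, `T⊗T' - S⊗S'` is half of `(T - S)⊗(T' + S') + (T + S)⊗(T' - S')`. The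
  -- differences are `±D`, `±D'`, so each half is a signed-sum relation paired with a fixed element.
  have e := congrArg (fun X => f X D') hs
  have e' := congrArg (f D) hs'
  simp only [map_add, map_sub, map_smul, LinearMap.add_apply, LinearMap.sub_apply,
    LinearMap.smul_apply, map_zero, LinearMap.zero_apply] at e e' ⊢
  linear_combination (norm := module) (1 / 2 : ℂ) • e + (1 / 2 : ℂ) • e'

/-! ### The concrete XX matrices as instances of `rmat`. -/

section OneSpecies

variable {V : Type*} [AddCommGroup V] [Module ℂ V] (𝒱 : ZMod 2 → Submodule ℂ V)
  [DirectSum.Decomposition 𝒱] (π : Module.End ℂ V)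

theorem RXX_eq_rmat (l : ℂ) : RXX 𝒱 π l = rmat (P 𝒱) (op1 π) (op2 π) l := by
  simp only [RXX, rmat, Sig, op1_sub, op2_sub, op1_one, op2_one]

theorem leg12_RXX (l : ℂ) :
    leg12 (RXX 𝒱 π l) = rmat (leg12 (P 𝒱)) (leg12 (op1 π)) (leg12 (op2 π)) l := by
  rw [RXX_eq_rmat]
  exact map_rmat (A := Module.End ℂ (V ⊗[ℂ] V))
    (B := Module.End ℂ (V ⊗[ℂ] V ⊗[ℂ] V)) (leg12Hom V) _ _ _ l

theorem leg12_RXX_parity (l : ℂ) :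
    leg12 (RXX 𝒱 π l * op1 (C π)) =
      rmat (leg12 (P 𝒱)) (leg12 (op1 π)) (leg12 (op2 π)) l * parity (leg12 (op1 π)) := by
  rw [← leg12_RXX, op1_C, ← leg12Hom_apply, map_mul]
  exact congrArg _ (map_parity (A := Module.End ℂ (V ⊗[ℂ] V))
    (B := Module.End ℂ (V ⊗[ℂ] V ⊗[ℂ] V)) (leg12Hom V) (op1 π))

theorem leg23_RXX (l : ℂ) :
    leg23 (RXX 𝒱 π l) = rmat (leg23 (P 𝒱)) (leg12 (op2 π)) (leg23 (op2 π)) l := by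
  rw [RXX_eq_rmat, ← leg23_op1]
  exact map_rmat (A := Module.End ℂ (V ⊗[ℂ] V))
    (B := Module.End ℂ (V ⊗[ℂ] V ⊗[ℂ] V)) (leg23Hom V) _ _ _ l

theorem leg23_RXX_parity (l : ℂ) :
    leg23 (RXX 𝒱 π l * op1 (C π)) =
      rmat (leg23 (P 𝒱)) (leg12 (op2 π)) (leg23 (op2 π)) l * parity (leg12 (op2 π)) := by
  rw [← leg23_RXX, op1_C, ← leg23Hom_apply, map_mul, ← leg23_op1]
  exact congrArg _ (map_parity (A := Module.End ℂ (V ⊗[ℂ] V))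
    (B := Module.End ℂ (V ⊗[ℂ] V ⊗[ℂ] V)) (leg23Hom V) (op1 π))

theorem leg13_RXX (l : ℂ) :
    leg13 𝒱 (RXX 𝒱 π l) =
      leg23 (P 𝒱) * rmat (leg12 (P 𝒱)) (leg12 (op1 π)) (leg12 (op2 π)) l * leg23 (P 𝒱) := by
  rw [leg13, leg12_RXX]

theorem leg13_RXX_parity (l : ℂ) :
    leg13 𝒱 (RXX 𝒱 π l * op1 (C π)) =
      leg23 (P 𝒱) * rmat (leg12 (P 𝒱)) (leg12 (op1 π)) (leg12 (op2 π)) l * leg23 (P 𝒱) *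
        parity (leg12 (op1 π)) := by
  rw [leg13, leg12_RXX_parity]
  exact conj_mul_parity (leg12_op1_commute π (P 𝒱)) _

variable {π} (hπ : IsIdempotentElem π) (heven : ∀ i, ∀ v ∈ 𝒱 i, π v ∈ 𝒱 i)
include hπ heven

theorem leg21_RXX (l : ℂ) : leg21 𝒱 (RXX 𝒱 π l) = rmat (P 𝒱) (op1 π) (op2 π) l := by
  rw [leg21, RXX_eq_rmat, (twoSites 𝒱 hπ heven).conj_rmat]

theorem leg21_RXX_parity (l : ℂ) :
    leg21 𝒱 (RXX 𝒱 π l * op1 (C π)) = rmat (P 𝒱) (op1 π) (op2 π) l * parity (op2 π) := by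
  rw [leg21, RXX_eq_rmat, op1_C, (twoSites 𝒱 hπ heven).conj_rmat_parity]

end OneSpecies

namespace ThreeSites

open Complex in
theorem coupling_sum_eq_zero {A : Type*} [Ring A] [Algebra ℂ A] {P Q p₁ p₂ p₃ : A}
    (H : ThreeSites P Q p₁ p₂ p₃) {x y z k t c₁ c₂ c₃ c₄ : ℂ}
    (h₁ : c₁ = k * (sin (x - y) * cos (x - y)) + t * (sin (x - y) * (sin (x + z) * sin (y + z))))
    (h₂ : c₂ = k * (sin (x - z) * cos (x - z)) + t * (sin (x - z) * (sin (x + y) * sin (y + z))))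
    (h₃ : c₃ = k * (sin (y - z) * cos (y - z)) + t * (sin (y - z) * (sin (x + y) * sin (x + z))))
    (h₄ : c₄ = t * (sin (x - y) * sin (x - z) * sin (y - z))) :
    c₁ • (fwd P Q p₁ p₂ p₃ (parity p₁) 1 1 (x + y) (x - z) (y - z) +
        bwd P Q p₁ p₂ p₃ (parity p₁) 1 1 (x + y) (x - z) (y - z)) -
      c₂ • (fwd P Q p₁ p₂ p₃ 1 (parity p₁) 1 (x - y) (x + z) (y - z) +
        bwd P Q p₁ p₂ p₃ 1 (parity p₁) 1 (x - y) (x + z) (y - z)) +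
      c₃ • (fwd P Q p₁ p₂ p₃ 1 1 (parity p₂) (x - y) (x - z) (y + z) +
        bwd P Q p₁ p₂ p₃ 1 1 (parity p₂) (x - y) (x - z) (y + z)) -
      c₄ • (fwd P Q p₁ p₂ p₃ (parity p₁) (parity p₁) (parity p₂) (x + y) (x + z) (y + z) +
        bwd P Q p₁ p₂ p₃ (parity p₁) (parity p₁) (parity p₂) (x + y) (x + z) (y + z)) = 0 := by
  have e₁ := H.sum_eq_zero x y z
  have e₂ := H.sum_eq_zero_all x y z
  subst h₁ h₂ h₃ h₄
  linear_combination (norm := module) k • e₁ + t • e₂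

end ThreeSites

/-! ### The Hubbard matrix on the tensor product of the species. -/

section Tensor

variable {E F : Type*} [AddCommGroup E] [Module ℂ E] [AddCommGroup F] [Module ℂ F]

open Complex in
theorem tensor_yang_baxter {P Q p₁ p₂ p₃ : Module.End ℂ E} (H : ThreeSites P Q p₁ p₂ p₃)
    {P' Q' p₁' p₂' p₃' : Module.End ℂ F} (H' : ThreeSites P' Q' p₁' p₂' p₃')
    {x y z k t c₁ c₂ c₃ : ℂ}
    (h₁ : c₁ = k * (sin (x - y) * cos (x - y)) + t * (sin (x - y) * (sin (x + z) * sin (y + z))))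
    (h₂ : c₂ = k * (sin (x - z) * cos (x - z)) + t * (sin (x - z) * (sin (x + y) * sin (y + z))))
    (h₃ : c₃ = k * (sin (y - z) * cos (y - z)) + t * (sin (y - z) * (sin (x + y) * sin (x + z))))
    (h₄ : c₁ * c₂ * c₃ = t * (sin (x - y) * sin (x - z) * sin (y - z)))
    {R₁₂ R₁₃ R₂₃ : Module.End ℂ (E ⊗[ℂ] F)}
    (e₁₂ : R₁₂ = TensorProduct.map (rmat P p₁ p₂ (x - y)) (rmat P' p₁' p₂' (x - y)) +
      c₁ • TensorProduct.map (rmat P p₁ p₂ (x + y) * parity p₁)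
        (rmat P' p₁' p₂' (x + y) * parity p₁'))
    (e₁₃ : R₁₃ =
      TensorProduct.map (Q * rmat P p₁ p₂ (x - z) * Q) (Q' * rmat P' p₁' p₂' (x - z) * Q') +
      c₂ • TensorProduct.map (Q * rmat P p₁ p₂ (x + z) * Q * parity p₁)
        (Q' * rmat P' p₁' p₂' (x + z) * Q' * parity p₁'))
    (e₂₃ : R₂₃ = TensorProduct.map (rmat Q p₂ p₃ (y - z)) (rmat Q' p₂' p₃' (y - z)) +
      c₃ • TensorProduct.map (rmat Q p₂ p₃ (y + z) * parity p₂)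
        (rmat Q' p₂' p₃' (y + z) * parity p₂')) :
    R₁₂ * R₁₃ * R₂₃ = R₂₃ * R₁₃ * R₁₂ := by
  -- The four terms with one or three parity insertions agree only after summation with the coupling
  -- weights.
  have odd := bilinear_sum_eq (TensorProduct.mapBilinear (.id ℂ) E F E F)
    (H.difference_one_three x y z) (H.difference_two_three x y z)
    (H.difference_all x y z) (H'.difference_one_three x y z) (H'.difference_two_three x y z)
    (H'.difference_all x y z) (H.coupling_sum_eq_zero h₁ h₂ h₃ h₄)
    (H'.coupling_sum_eq_zero h₁ h₂ h₃ h₄)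
  -- The four terms with zero or two insertions agree one by one, whatever the couplings.
  have y₀ := congrArg₂ (TensorProduct.map) (H.yang_baxter_plain x y z) (H'.yang_baxter_plain x y z)
  have y₁ := congrArg₂ (TensorProduct.map) (H.yang_baxter_one x y z) (H'.yang_baxter_one x y z)
  have y₂ := congrArg₂ (TensorProduct.map) (H.yang_baxter_two x y z) (H'.yang_baxter_two x y z)
  have y₃ := congrArg₂ (TensorProduct.map) (H.yang_baxter_three x y z) (H'.yang_baxter_three x y z)
  simp only [fwd, bwd, mul_one, TensorProduct.mapBilinear_apply] at odd y₀ y₁ y₂ y₃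
  rw [e₁₂, e₁₃, e₂₃]
  simp only [mul_add, add_mul, smul_mul_assoc, mul_smul_comm, ← TensorProduct.map_mul]
  rw [y₀, y₁, y₂, y₃]
  linear_combination (norm := module) odd

open Complex in
-- The opposite weights `c` and `-c` cancel the cross terms; each species contributes a `cos²` to
-- the two remaining ones.
theorem tensor_unitarity {P p q : Module.End ℂ E} (H : TwoSites P p q) {P' p' q' : Module.End ℂ F}
    (H' : TwoSites P' p' q') {x y c : ℂ} {R₁₂ R₂₁ : Module.End ℂ (E ⊗[ℂ] F)}
    (e₁₂ : R₁₂ = TensorProduct.map (rmat P p q (x - y)) (rmat P' p' q' (x - y)) +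
      c • TensorProduct.map (rmat P p q (x + y) * parity p) (rmat P' p' q' (x + y) * parity p'))
    (e₂₁ : R₂₁ = TensorProduct.map (rmat P p q (y - x)) (rmat P' p' q' (y - x)) +
      (-c) • TensorProduct.map (rmat P p q (y + x) * parity q)
        (rmat P' p' q' (y + x) * parity q')) :
    R₁₂ * R₂₁ = (cos (x - y) ^ 4 - c ^ 2 * cos (x + y) ^ 4) • 1 := by
  rw [e₁₂, e₂₁, ← neg_sub x y, add_comm y x]
  simp only [mul_add, add_mul, smul_mul_assoc, mul_smul_comm, ← TensorProduct.map_mul,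
    H.rmat_mul_rmat_neg,
    H'.rmat_mul_rmat_neg, H.rmat_parity_mul_rmat_parity, H'.rmat_parity_mul_rmat_parity,
    H.rmat_mul_rmat_parity, H'.rmat_mul_rmat_parity, TensorProduct.map_smul_left,
    TensorProduct.map_smul_right, TensorProduct.map_one]
  module

end Tensor

end UniversalHubbard

end

theorem mainTheorem2 {V W : Type*} [AddCommGroup V] [Module ℂ V] [AddCommGroup W] [Module ℂ W]
    (𝒱 : ZMod 2 → Submodule ℂ V) [DirectSum.Decomposition 𝒱]
    (𝒲 : ZMod 2 → Submodule ℂ W) [DirectSum.Decomposition 𝒲]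
    (πup : Module.End ℂ V) (hπup : IsIdempotentElem πup)
    (hπup_even : ∀ i, ∀ v ∈ 𝒱 i, πup v ∈ 𝒱 i)
    (πdn : Module.End ℂ W) (hπdn : IsIdempotentElem πdn)
    (hπdn_even : ∀ i, ∀ w ∈ 𝒲 i, πdn w ∈ 𝒲 i)
    (U : ℂ) (h : ℂ → ℂ) (hh : ∀ l : ℂ, Complex.sinh (2 * h l) = U * Complex.sin (2 * l)) :
    (∀ l₁ l₂ l₃ : ℂ,
      Complex.sin (l₁ + l₂) ≠ 0 → Complex.sin (l₁ + l₃) ≠ 0 → Complex.sin (l₂ + l₃) ≠ 0 →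
      Complex.cosh (h l₁ + h l₂) ≠ 0 → Complex.cosh (h l₁ + h l₃) ≠ 0 →
      Complex.cosh (h l₂ + h l₃) ≠ 0 →
        UniversalHubbard.hubbardThree12 𝒱 𝒲 πup πdn h l₁ l₂ *
            UniversalHubbard.hubbardThree13 𝒱 𝒲 πup πdn h l₁ l₃ *
            UniversalHubbard.hubbardThree23 𝒱 𝒲 πup πdn h l₂ l₃ =
          UniversalHubbard.hubbardThree23 𝒱 𝒲 πup πdn h l₂ l₃ *
            UniversalHubbard.hubbardThree13 𝒱 𝒲 πup πdn h l₁ l₃ *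
            UniversalHubbard.hubbardThree12 𝒱 𝒲 πup πdn h l₁ l₂) ∧
    (∀ l₁ l₂ : ℂ, Complex.sin (l₁ + l₂) ≠ 0 → Complex.cosh (h l₁ + h l₂) ≠ 0 →
      UniversalHubbard.hubbard12 𝒱 𝒲 πup πdn h l₁ l₂ *
          UniversalHubbard.hubbard21 𝒱 𝒲 πup πdn h l₂ l₁ =
        (Complex.cos (l₁ - l₂) ^ 4 -
          (Complex.sin (l₁ - l₂) / Complex.sin (l₁ + l₂) * Complex.tanh (h l₁ + h l₂)) ^ 2 *
            Complex.cos (l₁ + l₂) ^ 4) •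
          (1 : Module.End ℂ ((V ⊗[ℂ] V) ⊗[ℂ] (W ⊗[ℂ] W)))) ∧
    (∀ l₁ l₂ : ℂ, Complex.sin (l₁ + l₂) ≠ 0 → Complex.cosh (h l₁ + h l₂) ≠ 0 →
      Complex.cosh (h l₁ - h l₂) ≠ 0 →
        Complex.cos (l₁ - l₂) ^ 4 -
            (Complex.sin (l₁ - l₂) / Complex.sin (l₁ + l₂) * Complex.tanh (h l₁ + h l₂)) ^ 2 *
              Complex.cos (l₁ + l₂) ^ 4 =
          Complex.cos (l₁ - l₂) ^ 2 *
            (Complex.cos (l₁ - l₂) ^ 2 -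
              (Complex.tanh (h l₁ - h l₂) * Complex.cos (l₁ + l₂)) ^ 2)) ∧
    (∀ l₁ l₂ : ℂ, Complex.sin (l₁ + l₂) ≠ 0 → Complex.cos (l₁ + l₂) ≠ 0 →
      Complex.cosh (h l₁ + h l₂) ≠ 0 → Complex.cosh (h l₁ - h l₂) ≠ 0 →
        Complex.cos (l₁ - l₂) ^ 4 -
            (Complex.sin (l₁ - l₂) / Complex.sin (l₁ + l₂) * Complex.tanh (h l₁ + h l₂)) ^ 2 =
          Complex.cos (l₁ - l₂) ^ 2 *
            (Complex.cos (l₁ - l₂) ^ 2 -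
              (Complex.tanh (h l₁ - h l₂) / Complex.cos (l₁ + l₂)) ^ 2)) := by
  open UniversalHubbard in
  refine ⟨fun x y z hxy hxz hyz cxy cxz cyz => ?_, fun x y hs hc => ?_, fun x y hs hc hc' => ?_,
    fun x y hs hs' hc hc' => ?_⟩
  · obtain ⟨k, t, h₁, h₂, h₃, h₄⟩ := exists_coupling_eq hh hxy hxz hyz cxy cxz cyz
    refine tensor_yang_baxter (threeSites 𝒱 hπup hπup_even)
      (threeSites 𝒲 hπdn hπdn_even) h₁ h₂ h₃ h₄ ?_ ?_ ?_
    · rw [hubbardThree12, hubbardR]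
      simp only [leg12_RXX, leg12_RXX_parity]
    · rw [hubbardThree13, hubbardR]
      simp only [leg13_RXX, leg13_RXX_parity]
    · rw [hubbardThree23, hubbardR]
      simp only [leg23_RXX, leg23_RXX_parity]
  · refine tensor_unitarity (twoSites 𝒱 hπup hπup_even)
      (twoSites 𝒲 hπdn hπdn_even) (c := coupling h x y) ?_ ?_
    · rw [hubbard12, hubbardR]
      simp only [id, RXX_eq_rmat, op1_C]
    · rw [hubbard21, hubbardR, coupling_swap h x y]
      simp only [leg21_RXX 𝒱 hπup hπup_even, leg21_RXX_parity 𝒱 hπup hπup_even,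
        leg21_RXX 𝒲 hπdn hπdn_even, leg21_RXX_parity 𝒲 hπdn hπdn_even]
  · have := coupling_mul_cos hh hs hc hc'
    -- The two sides differ by `-cos²(x + y)` times a difference of squares, whose factor `A - B` is
    -- `this`.
    linear_combination -Complex.cos (x + y) ^ 2 *
      (Complex.sin (x - y) / Complex.sin (x + y) * Complex.tanh (h x + h y) * Complex.cos (x + y) +
        Complex.tanh (h x - h y) * Complex.cos (x - y)) * this
  · rw [eq_div_of_mul_eq hs' (coupling_mul_cos hh hs hc hc')]
    ring
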